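/- Let $\sigma(t)=\max(t,0)$ act componentwise. Let $d\ge 1$, $l\ge 1$ and $k\in\{1,\dots,d\}$ be integers and put $n=\lceil d/k\rceil$. For $y\in\mathbb{R}^d$ and $i=1,\dots,n$ let $y_i\in\mathbb{R}^k$ be the $i$-th chunk of $y$, i.e. its coordinates $(i-1)k+1,\dots,ik$, where coordinates beyond $d$ are replaced by $0$. Target network. Let $W^*_j\in\mathbb{R}^{d\times d}$, let $\Gamma^*_j\in\mathbb{R}^{d\times d}$ be diagonal and $\beta^*_j\in\mathbb{R}^d$ ($j=1,\dots,l$), and let $$g(x)=\Gamma_l^*W_l^*\,\sigma\bigl(\Gamma_{l-1}^*W_{l-1}^*\,\sigma(\cdots\sigma(\Gamma_1^*W_1^*x+\beta_1^*)\cdots)+\beta_{l-1}^*\bigr)+\beta_l^* .$$ Split the columns of $\Gamma^*_jW^*_j$ into the $n$ consecutive blocks that act on the chunks $y_1,\dots,y_n$. Assume that none of these blocks is the zero matrix, or, more generally, that for every $j$ a zero block of $\Gamma_j^*W_j^*$ is preceded by zero blocks only. Random network. For $j=1,\dots,l$ and $i=1,\dots,n$ let $W_i^j\in\mathbb{R}^{dk\times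 dk}$, $P_i^j\in\mathbb{R}^{dk\times k}$ and $W_{n+1}^j\in\mathbb{R}^{d\times dk}$ be random matrices such that all entries of all these matrices are independent real random variables with continuous (i.e. atomless) distributions; the distributions may be arbitrary and need not be equal. These matrices are frozen. For diagonal $\Gamma_i^j\in\mathbb{R}^{dk\times dk}$ and $\beta_i^j\in\mathbb{R}^{dk}$ (the normalization parameters) define, for $y\in\mathbb{R}^d$, $$L_1^j=\Gamma_1^jW_1^jP_1^jy_1+\beta_1^j,\qquad L_i^j=\Gamma_i^jW_i^j\bigl(\sigma(L_{i-1}^j)+P_i^jy_i\bigr)+\beta_i^j\quad(i=2,\dots,n),$$ and $f^j(y)=\sigma(W_{n+1}^jL_n^j)$ for $j<l$, $f^l(y)=W_{n+1}^lL_n^l$ (no activation after the last layer). Thus $f^l\circ\cdots\circ f^1$ is a network with skip connections of depth $l(n+1)$ and width $dk$. Then, with probability $1$ over the frozen matrices, there are normalization parameters $\Gamma_i^j,\beta_i^j$ ($i=1,\dots,n$, $j=1,\dots,l$) such that $$g(x)=f^l(f^{l-1}(\cdots f^1(x)\cdots))\qquad\text{for all }x\in\mathbb{R}^d\text{ with }\|x\|_2\le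 1 .$$ -/

import Mathlib

open MeasureTheory ProbabilityTheory

namespace NormNet

/-- The componentwise ReLU activation. -/
def relu {ι : Type*} (v : ι → ℝ) : ι → ℝ := fun a => max (v a) 0

/-- `composeLayers l F = F (l-1) ∘ ⋯ ∘ F 1 ∘ F 0`. -/
def composeLayers {V : Type*} : (l : ℕ) → (Fin l → V → V) → V → V
  | 0, _, x => x
  | l + 1, F, x => F (Fin.last l) (composeLayers l (fun j => F j.castSucc) x)

/-- The activation after the `j`-th of `l` layers: ReLU, except after the last layer, where
there is none. -/
def activate {l : ℕ} {ι : Type*} (j : Fin l) (v : ι → ℝ) : ι → ℝ :=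
  if (j : ℕ) + 1 = l then v else relu v

/-- The target network
`g x = Γ_l W_l relu (⋯ relu (Γ_1 W_1 x + β_1) ⋯) + β_l` of depth `l` and width `d`; the scaling
matrix `Γ_j` is diagonal with diagonal `γ j`. -/
def targetNet {l d : ℕ} (W : Fin l → Matrix (Fin d) (Fin d) ℝ) (γ β : Fin l → Fin d → ℝ) :
    (Fin d → ℝ) → Fin d → ℝ :=
  composeLayers l fun j y =>
    activate j ((Matrix.diagonal (γ j)).mulVec ((W j).mulVec y) + β j)

/-- The `i`-th chunk of length `k` of a vector (chunks are numbered from `0`): the coordinates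
`i k, …, i k + k - 1`, where missing coordinates are filled up with `0`. -/
def chunk {d : ℕ} (k : ℕ) (y : Fin d → ℝ) (i : ℕ) : Fin k → ℝ := fun a =>
  if h : i * k + a < d then y ⟨i * k + a, h⟩ else 0

/-- The block of columns of `A` that acts on the `i`-th chunk of the input. -/
def columnBlock {d : ℕ} (k : ℕ) (A : Matrix (Fin d) (Fin d) ℝ) (i : ℕ) :
    Matrix (Fin d) (Fin k) ℝ :=
  Matrix.of fun r => chunk k (A r) i

/-- The entries of all frozen matrices of the deep network. For each layer `j` of the target and
each of the `⌈d / k⌉` chunks `i` there is a matrix `W_i^j` of size `dk × dk` (`inner`) and a matrix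
`P_i^j` of size `dk × k` (`proj`), and for each `j` a matrix of size `d × dk` (`out`). -/
inductive WeightEntry (l d k : ℕ) : Type
  | inner (j : Fin l) (i : Fin (d ⌈/⌉ k)) (r c : Fin (d * k))
  | proj (j : Fin l) (i : Fin (d ⌈/⌉ k)) (r : Fin (d * k)) (c : Fin k)
  | out (j : Fin l) (r : Fin d) (c : Fin (d * k))
  deriving DecidableEq, Fintype

section DeepNet

variable {l d k : ℕ}

/-- The square matrix `W_i^j`. -/
def innerMat (w : WeightEntry l d k → ℝ) (j : Fin l) (i : Fin (d ⌈/⌉ k)) :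
    Matrix (Fin (d * k)) (Fin (d * k)) ℝ :=
  Matrix.of fun r c => w (.inner j i r c)

/-- The matrix `P_i^j` through which the `i`-th chunk of the input is fed in. -/
def projMat (w : WeightEntry l d k → ℝ) (j : Fin l) (i : Fin (d ⌈/⌉ k)) :
    Matrix (Fin (d * k)) (Fin k) ℝ :=
  Matrix.of fun r c => w (.proj j i r c)

/-- The last matrix of the `j`-th block, which maps back to dimension `d`. -/
def outMat (w : WeightEntry l d k → ℝ) (j : Fin l) : Matrix (Fin d) (Fin (d * k)) ℝ :=
  Matrix.of fun r c => w (.out j r c)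

/-- The vectors `L_i` of the `j`-th block on the input `y`, with `γ`, `β` the scaling and shifting
parameters of that block:
`L_1 = Γ_1 W_1 P_1 y_1 + β_1` and `L_{i+1} = Γ_{i+1} W_{i+1} (relu L_i + P_{i+1} y_{i+1}) + β_{i+1}`.
With `L_0 = 0` the second formula covers the first one. -/
def blockPreact (w : WeightEntry l d k → ℝ) (j : Fin l) (γ β : Fin (d ⌈/⌉ k) → Fin (d * k) → ℝ)
    (y : Fin d → ℝ) : (i : ℕ) → i ≤ d ⌈/⌉ k → Fin (d * k) → ℝ
  | 0, _ => 0
  | i + 1, h =>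
    (Matrix.diagonal (γ ⟨i, h⟩)).mulVec ((innerMat w j ⟨i, h⟩).mulVec
      (relu (blockPreact w j γ β y i (Nat.le_of_succ_le h)) +
        (projMat w j ⟨i, h⟩).mulVec (chunk k y i))) + β ⟨i, h⟩

/-- The network with skip connections that consists of `l` blocks of `⌈d / k⌉ + 1` layers each.
Its frozen weights are `w`; its normalization parameters are `γ` (the diagonals of the scaling
matrices) and `β` (the shifts). -/
def deepNet (w : WeightEntry l d k → ℝ) (γ β : Fin l → Fin (d ⌈/⌉ k) → Fin (d * k) → ℝ) :
    (Fin d → ℝ) → Fin d → ℝ :=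
  composeLayers l fun j y =>
    activate j ((outMat w j).mulVec (blockPreact w j (γ j) (β j) y (d ⌈/⌉ k) le_rfl))

end DeepNet

end NormNet

/-!
Fix one target layer `y ↦ A y + b` and let `A_i` be the block of columns of `A` that acts on the
`i`-th chunk. On a compact set of inputs, large shifts keep all hidden preactivations of a block
nonnegative, so that the block is an affine map there (`exists_shift_blockPreact`). It equals
`y ↦ A y + b` if the output matrix `U` has full row rank, which takes care of `b` and holds almost
surely (`exists_polynomial_outMat_surjective`), and if
`U Γ_n W_n ⋯ Γ_i W_i P_i = A_i` for all `i` (`outMat_mulVec_blockLinear`). Continuous images of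
compact sets are compact, so the layers can be treated one by one (`exists_composeLayers_eq`).

The equations are solved from `i = n` downwards. With `V = U Γ_n W_n ⋯ Γ_{i+1} W_{i+1}` known, the
equation `V Γ_i (W_i P_i) = A_i` is a linear system of `d k` equations in the `d k` diagonal entries
of `Γ_i`; its matrix is `khatriRao`. A zero block is solved by `Γ_i = 0`, which is compatible with
the equations for smaller `i` because these blocks vanish as well. Otherwise Cramer's rule gives the
solution. If one omits the division by the determinant in Cramer's rule, all quantities become
polynomials in the weights (`backChain`), and the solutions are recovered wherever the determinants
`chainDet` do not vanish (`exists_scaling_of_chainDet_ne_zero`).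

A nonzero polynomial almost surely does not vanish at independent atomless random variables
(`ae_eval_ne_zero`). So it suffices that each determinant is nonzero for one choice of weights. Take
`W_i = 1`, and choose `U` and `P_i` with `U P_i = A_i` such that the system with `V = U` and
`Q = P_i` is regular for each nonzero block (`exists_common_regular`). Then `Γ_i = 1` is a solution,
the matrix `V` stays `U` up to a factor, and all systems are regular (`chainDet_one_ne_zero`).
-/

namespace NormNet

/-! ### The linear system for the scaling parameters -/

section KhatriRao

variable {D K ι R S : Type*} [CommRing R] [CommRing S]

/-- The matrix of the linear map `γ ↦ V * diagonal γ * Q`. The entries of the result are listed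
along a bijection `e` of `ι` with the set of positions, so that the matrix is square. Up to this
reordering of rows it is a transposed Khatri–Rao product of `V` and `Q`. -/
def khatriRao (e : ι ≃ D × K) (V : Matrix D ι R) (Q : Matrix ι K R) : Matrix ι ι R :=
  Matrix.of fun t s => V (e t).1 s * Q s (e t).2

lemma khatriRao_map (f : R →+* S) (e : ι ≃ D × K) (V : Matrix D ι R) (Q : Matrix ι K R) :
    (khatriRao e V Q).map f = khatriRao e (V.map f) (Q.map f) := by
  ext t s
  simp [khatriRao]

variable [Fintype ι] [DecidableEq ι]

lemma khatriRao_mulVec (e : ι ≃ D × K) (V : Matrix D ι R) (Q : Matrix ι K R) (γ : ι → R) (t : ι) :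
    (khatriRao e V Q).mulVec γ t = (V * Matrix.diagonal γ * Q) (e t).1 (e t).2 := by
  rw [Matrix.mul_apply]
  simp only [khatriRao, Matrix.mulVec, dotProduct, Matrix.of_apply, Matrix.mul_diagonal]
  exact Finset.sum_congr rfl fun s _ => by ring

/-- The scaling vector that solves `V * diagonal γ * Q = det • A`, with `det` the determinant of the
system. It is a polynomial in the entries of `V`, `Q` and `A`. -/
def adjugateScaling (e : ι ≃ D × K) (V : Matrix D ι R) (Q : Matrix ι K R) (A : Matrix D K R) :
    ι → R :=
  (khatriRao e V Q).adjugate.mulVec fun t => A (e t).1 (e t).2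

lemma mul_diagonal_adjugateScaling_mul (e : ι ≃ D × K) (V : Matrix D ι R) (Q : Matrix ι K R)
    (A : Matrix D K R) :
    V * Matrix.diagonal (adjugateScaling e V Q A) * Q = (khatriRao e V Q).det • A := by
  ext r c
  have h := khatriRao_mulVec e V Q (adjugateScaling e V Q A) (e.symm (r, c))
  simp only [Equiv.apply_symm_apply] at h
  rw [← h, adjugateScaling, Matrix.mulVec_mulVec, Matrix.mul_adjugate, Matrix.smul_mulVec,
    Matrix.one_mulVec]
  simp

/-- The products `V * diagonal γ₀ * W₀ * diagonal γ₁ * W₁ ⋯`, in which each `γₘ` is the adjugate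
scaling that makes the product with `Pₘ` a multiple of `Aₘ`. -/
def backChain (e : ι ≃ D × K) (A : ℕ → Matrix D K R) (W : ℕ → Matrix ι ι R)
    (P : ℕ → Matrix ι K R) (V : Matrix D ι R) : ℕ → Matrix D ι R
  | 0 => V
  | m + 1 => backChain e A W P V m *
      Matrix.diagonal (adjugateScaling e (backChain e A W P V m) (W m * P m) (A m)) * W m

/-- The determinant of the linear system solved in step `m` of `backChain`. -/
def chainDet (e : ι ≃ D × K) (A : ℕ → Matrix D K R) (W : ℕ → Matrix ι ι R)
    (P : ℕ → Matrix ι K R) (V : Matrix D ι R) (m : ℕ) : R :=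
  (khatriRao e (backChain e A W P V m) (W m * P m)).det

lemma adjugateScaling_map (f : R →+* S) (e : ι ≃ D × K) (V : Matrix D ι R) (Q : Matrix ι K R)
    (A : Matrix D K R) :
    (fun s => f (adjugateScaling e V Q A s)) =
      adjugateScaling e (V.map f) (Q.map f) (A.map f) := by
  funext s
  rw [adjugateScaling, RingHom.map_mulVec, adjugateScaling, ← khatriRao_map,
    ← RingHom.mapMatrix_apply f (khatriRao e V Q), ← RingHom.map_adjugate]
  rfl

lemma backChain_map (f : R →+* S) (e : ι ≃ D × K) (A : ℕ → Matrix D K R) (W : ℕ → Matrix ι ι R)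
    (P : ℕ → Matrix ι K R) (V : Matrix D ι R) (m : ℕ) :
    (backChain e A W P V m).map f = backChain e (fun i => (A i).map f) (fun i => (W i).map f)
      (fun i => (P i).map f) (V.map f) m := by
  induction m with
  | zero => rfl
  | succ m ih =>
    have h := adjugateScaling_map f e (backChain e A W P V m) (W m * P m) (A m)
    rw [ih, Matrix.map_mul] at h
    rw [backChain, backChain, Matrix.map_mul, Matrix.map_mul, ih,
      Matrix.diagonal_map (map_zero f), ← h]

lemma chainDet_map (f : R →+* S) (e : ι ≃ D × K) (A : ℕ → Matrix D K R) (W : ℕ → Matrix ι ι R)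
    (P : ℕ → Matrix ι K R) (V : Matrix D ι R) (m : ℕ) :
    f (chainDet e A W P V m) = chainDet e (fun i => (A i).map f) (fun i => (W i).map f)
      (fun i => (P i).map f) (V.map f) m := by
  rw [chainDet, RingHom.map_det, RingHom.mapMatrix_apply, khatriRao_map, backChain_map,
    Matrix.map_mul, chainDet]

/-- Where the determinants do not vanish, division by them turns `backChain` into exact solutions.
The targets from index `N` on are zero and are reached with zero scalings. -/
lemma exists_scaling_of_chainDet_ne_zero (e : ι ≃ D × K) (A : ℕ → Matrix D K ℝ)
    (W : ℕ → Matrix ι ι ℝ) (P : ℕ → Matrix ι K ℝ) (V₀ : Matrix D ι ℝ) (N : ℕ)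
    (hN : ∀ m < N, chainDet e A W P V₀ m ≠ 0) :
    ∃ (γ : ℕ → ι → ℝ) (V : ℕ → Matrix D ι ℝ), V 0 = V₀ ∧ ∀ m, (N ≤ m → A m = 0) →
      V (m + 1) = V m * Matrix.diagonal (γ m) * W m ∧ V (m + 1) * P m = A m := by
  -- `backChain` at `m` is `c m` times the exact product.
  let c : ℕ → ℝ := fun m => Nat.casesOn m 1 (chainDet e A W P V₀)
  let T := backChain e A W P V₀
  refine ⟨fun m => if m < N then
      (c m / c (m + 1)) • adjugateScaling e (T m) (W m * P m) (A m) else 0,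
    fun m => if m ≤ N then (c m)⁻¹ • T m else 0, ?_, ?_⟩
  · simp [c, T, backChain]
  intro m hA
  by_cases hm : m < N
  · have hc1 : c (m + 1) ≠ 0 := hN m hm
    have hc0 : c m ≠ 0 := by
      cases m with
      | zero => exact one_ne_zero
      | succ m => exact hN m (by omega)
    have hT : T (m + 1) = T m * Matrix.diagonal
        (adjugateScaling e (T m) (W m * P m) (A m)) * W m := rfl
    beta_reduce
    rw [if_pos (Nat.succ_le_of_lt hm), if_pos hm.le, if_pos hm]
    constructor
    · rw [hT, Matrix.diagonal_smul, Matrix.smul_mul, Matrix.mul_smul, smul_smul, Matrix.smul_mul]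
      congr 1
      field_simp
    · rw [hT, Matrix.smul_mul, Matrix.mul_assoc _ (W m), mul_diagonal_adjugateScaling_mul]
      exact inv_smul_smul₀ hc1 _
  · beta_reduce
    rw [if_neg (by omega), if_neg hm, hA (by omega)]
    constructor <;> simp

end KhatriRao

/-! ### Weights for which the systems are regular -/

section Witness

variable {D K ι : Type*} [Fintype ι] [DecidableEq ι]

/-- If all inner matrices are `1` and `V * P m = A m`, then the all-ones vector solves each system,
so that `backChain` only rescales `V` and all systems are regular. -/
lemma chainDet_one_ne_zero (e : ι ≃ D × K) (A : ℕ → Matrix D K ℝ) (P : ℕ → Matrix ι K ℝ)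
    (V : Matrix D ι ℝ) (N : ℕ)
    (hP : ∀ m < N, V * P m = A m ∧ (khatriRao e V (P m)).det ≠ 0) :
    ∀ m < N, chainDet e A (fun _ => 1) P V m ≠ 0 := by
  have hsmul : ∀ (c : ℝ) (Q : Matrix ι K ℝ), khatriRao e (c • V) Q = c • khatriRao e V Q := by
    intro c Q
    ext t s
    simp [khatriRao, mul_assoc]
  have hdet : ∀ (c : ℝ) (Q : Matrix ι K ℝ), c ≠ 0 → (khatriRao e V Q).det ≠ 0 →
      (khatriRao e (c • V) Q).det ≠ 0 := by
    intro c Q hc hQ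
    rw [hsmul, Matrix.det_smul]
    exact mul_ne_zero (pow_ne_zero _ hc) hQ
  have key : ∀ m ≤ N, ∃ c : ℝ, c ≠ 0 ∧ backChain e A (fun _ => 1) P V m = c • V := by
    intro m
    induction m with
    | zero => exact fun _ => ⟨1, one_ne_zero, (one_smul _ _).symm⟩
    | succ m ih =>
      intro hm
      obtain ⟨c, hc, h⟩ := ih (by omega)
      obtain ⟨hVP, hd⟩ := hP m hm
      have hd' := hdet c (P m) hc hd
      have hsol : adjugateScaling e (c • V) (P m) (A m) =
          fun _ => (khatriRao e (c • V) (P m)).det * c⁻¹ := by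
        have h1 : (fun t => A m (e t).1 (e t).2) =
            (khatriRao e (c • V) (P m)).mulVec fun _ => c⁻¹ := by
          funext t
          rw [khatriRao_mulVec, ← hVP]
          simp [← Matrix.smul_eq_mul_diagonal, smul_smul, inv_mul_cancel₀ hc]
        rw [adjugateScaling, h1, Matrix.mulVec_mulVec, Matrix.adjugate_mul, Matrix.smul_mulVec,
          Matrix.one_mulVec]
        rfl
      refine ⟨(khatriRao e (c • V) (P m)).det, hd', ?_⟩
      rw [backChain, h, Matrix.one_mul, hsol, Matrix.mul_one, ← Matrix.smul_eq_mul_diagonal,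
        smul_smul, mul_assoc, inv_mul_cancel₀ hc, mul_one]
  intro m hm
  obtain ⟨c, hc, h⟩ := key m hm.le
  rw [chainDet, h, Matrix.one_mul]
  exact hdet c _ hc (hP m hm).2

/-- Finitely many nonzero matrices have a common regular matrix `S` such that no `S * A i` has a
zero row. -/
lemma exists_regular_mul_rows_ne_zero {d : ℕ} {I : Type*} [Finite I]
    (A : I → Matrix (Fin d) K ℝ) (hA : ∀ i, A i ≠ 0) :
    ∃ S : Matrix (Fin d) (Fin d) ℝ, S.det ≠ 0 ∧ ∀ i r, (S * A i) r ≠ 0 := by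
  classical
  have hcol : ∀ i, ∃ c r, A i r c ≠ 0 := by
    intro i
    by_contra! h
    exact hA i (by ext r c; exact h c r)
  choose c r hcr using hcol
  -- The rows `(1, t, t², …)` work for all `t` that are not a root of one of these polynomials.
  let q : I → Polynomial ℝ := fun i => ∑ a : Fin d, Polynomial.monomial (a : ℕ) (A i a (c i))
  have hq : ∀ i, q i ≠ 0 := by
    intro i h
    have := congrArg (fun p => Polynomial.coeff p (r i)) h
    simp only [q, Polynomial.finsetSum_coeff, Polynomial.coeff_monomial, Polynomial.coeff_zero,
      Fin.val_inj, Finset.sum_ite_eq', Finset.mem_univ, if_true] at this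
    exact hcr i this
  have hfin : (⋃ i, ((q i).roots.toFinset : Set ℝ)).Finite :=
    Set.finite_iUnion fun i => Finset.finite_toSet _
  have hinf := hfin.infinite_compl
  let t : Fin d ↪ ℝ := (Fin.valEmbedding.trans (hinf.natEmbedding _)).trans
    (Function.Embedding.subtype _)
  have ht : ∀ a i, (q i).eval (t a) ≠ 0 := by
    intro a i h
    have := (hinf.natEmbedding _ (a : ℕ)).2
    refine this (Set.mem_iUnion.2 ⟨i, ?_⟩)
    simpa [hq i, t] using h
  refine ⟨Matrix.vandermonde t, Matrix.det_vandermonde_ne_zero_iff.2 t.injective, ?_⟩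
  intro i a h
  apply ht a i
  have := congrFun h (c i)
  rw [Matrix.mul_apply] at this
  rw [Polynomial.eval_finsetSum]
  simpa [Matrix.vandermonde_apply, mul_comm] using this

variable [Fintype K] [DecidableEq K]

/-- A nonzero vector is the vector of column sums of a regular matrix. -/
lemma exists_regular_with_column_sums (v : K → ℝ) (hv : v ≠ 0) :
    ∃ B : Matrix K K ℝ, (∀ c, ∑ a, B a c = v c) ∧ ∀ x, Matrix.vecMul x B = 0 → x = 0 := by
  obtain ⟨c₀, hc₀⟩ := Function.ne_iff.1 hv
  rw [Pi.zero_apply] at hc₀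
  -- The identity matrix, with row `c₀` adjusted to the prescribed sums.
  have hsum : ∀ (x : K → ℝ) (c : K), (∑ a, x a * (if a = c₀ then v c - (if c = c₀ then 0 else 1)
      else if a = c then 1 else 0)) = x c₀ * v c + if c = c₀ then 0 else x c - x c₀ := by
    intro x c
    rw [← Finset.add_sum_erase _ _ (Finset.mem_univ c₀), if_pos rfl,
      Finset.sum_congr rfl (g := fun a => if a = c then x a else 0)
        (fun a ha => by rw [if_neg (Finset.ne_of_mem_erase ha)]; simp)]
    rw [Finset.sum_ite_eq']
    by_cases hc : c = c₀
    · simp [hc]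
    · simp [hc]
      ring
  refine ⟨Matrix.of fun a c => if a = c₀ then v c - (if c = c₀ then 0 else 1)
    else if a = c then 1 else 0, fun c => ?_, fun x hx => ?_⟩
  · simpa using hsum 1 c
  · have hx' : ∀ c, x c₀ * v c + (if c = c₀ then 0 else x c - x c₀) = 0 := fun c => by
      rw [← hsum]
      exact congrFun hx c
    have h0 : x c₀ = 0 := by simpa [hc₀] using hx' c₀
    funext c
    by_cases hc : c = c₀
    · rw [hc, h0]; rfl
    · simpa [hc, h0] using hx' c

/-- For finitely many nonzero targets `A i` there is one matrix `V` that reaches all of them, as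
`V * P = A i`, in such a way that the corresponding systems are regular. -/
lemma exists_common_regular {d : ℕ} {I : Type*} [Finite I] (e : ι ≃ Fin d × K)
    (A : I → Matrix (Fin d) K ℝ) (hA : ∀ i, A i ≠ 0) :
    ∃ V : Matrix (Fin d) ι ℝ, ∀ i, ∃ P : Matrix ι K ℝ,
      V * P = A i ∧ (khatriRao e V P).det ≠ 0 := by
  obtain ⟨S, hS, hSA⟩ := exists_regular_mul_rows_ne_zero A hA
  have hS' : IsUnit S.det := hS.isUnit
  -- `J` is `[1 1 ⋯ 1]` up to the order of the columns. Scaling and multiplying by `J` amounts to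
  -- `d` independent systems with the matrices `B r`.
  let J : Matrix (Fin d) ι ℝ := Matrix.of fun r s => if (e s).1 = r then 1 else 0
  have hJ : ∀ (Q : Matrix ι K ℝ) r c, (J * Q) r c = ∑ a, Q (e.symm (r, a)) c := by
    intro Q r c
    rw [Matrix.mul_apply, ← e.symm.sum_comp, Fintype.sum_prod_type,
      Finset.sum_eq_single_of_mem r (Finset.mem_univ r)]
    · simp [J]
    · intro b _ hb
      simp [J, hb]
  refine ⟨S⁻¹ * J, fun i => ?_⟩
  choose B hB1 hB2 using fun r => exists_regular_with_column_sums _ (hSA i r)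
  let P : Matrix ι K ℝ := Matrix.of fun s c => B (e s).1 (e s).2 c
  refine ⟨P, ?_, ?_⟩
  · have : J * P = S * A i := by
      ext r c
      rw [hJ]
      simpa [P] using hB1 r c
    rw [Matrix.mul_assoc, this, Matrix.nonsing_inv_mul_cancel_left _ _ hS']
  · intro hdet
    obtain ⟨γ, hγ, h0⟩ := Matrix.exists_mulVec_eq_zero_iff.2 hdet
    apply hγ
    have h1 : S⁻¹ * J * Matrix.diagonal γ * P = 0 := by
      ext r c
      have := congrFun h0 (e.symm (r, c))
      rw [khatriRao_mulVec] at this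
      simpa using this
    have h2 : J * (Matrix.diagonal γ * P) = 0 := by
      have := congrArg (S * ·) h1
      simpa only [Matrix.mul_assoc, Matrix.mul_nonsing_inv_cancel_left _ _ hS', Matrix.mul_zero]
        using this
    funext s
    have h3 := hB2 (e s).1 (fun a => γ (e.symm ((e s).1, a))) (by
      funext c
      have := congrFun (congrFun h2 (e s).1) c
      rw [hJ] at this
      simpa [P, Matrix.diagonal_mul, Matrix.vecMul, dotProduct] using this)
    simpa using congrFun h3 (e s).2

end Witness

/-! ### Polynomials in independent atomless random variables -/

lemma measurable_eval_mvPolynomial {σ : Type*} [Fintype σ] (p : MvPolynomial σ ℝ) :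
    Measurable fun x : σ → ℝ => MvPolynomial.eval x p :=
  (MvPolynomial.continuous_eval p).measurable

/-- The zero set of a nonzero polynomial is a null set for every product of atomless
probability measures. -/
lemma ae_eval_ne_zero_pi {n : ℕ} (ν : Fin n → Measure ℝ) [∀ i, IsProbabilityMeasure (ν i)]
    [∀ i, NullSingletonClass (ν i)] (p : MvPolynomial (Fin n) ℝ) (hp : p ≠ 0) :
    ∀ᵐ x ∂Measure.pi ν, MvPolynomial.eval x p ≠ 0 := by
  induction n with
  | zero =>
    refine Filter.Eventually.of_forall fun x h => hp ?_
    exact MvPolynomial.funext fun y => by rw [Subsingleton.elim y x, h, map_zero]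
  | succ n ih =>
    have hmp := (measurePreserving_piFinSuccAbove ν 0).symm
    have hmeas : MeasurableSet {x | MvPolynomial.eval x p ≠ 0} :=
      (measurable_eval_mvPolynomial p (measurableSet_singleton 0)).compl
    rw [← hmp.map_eq, ae_map_iff hmp.measurable.aemeasurable hmeas]
    -- For almost every value of the last variables some coefficient survives; then only finitely
    -- many values of the first variable are roots.
    set q := MvPolynomial.finSuccEquiv ℝ n p with hq
    have hq0 : q ≠ 0 := by simpa [hq] using hp
    have hcoeff : q.leadingCoeff ≠ 0 := Polynomial.leadingCoeff_ne_zero.2 hq0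
    have hswap : ∀ᵐ z ∂(Measure.pi fun i => ν (Fin.succAbove 0 i)).prod (ν 0),
        MvPolynomial.eval (Fin.cons z.2 z.1 : Fin (n + 1) → ℝ) p ≠ 0 := by
      have hm : Measurable fun z : (Fin n → ℝ) × ℝ => (Fin.cons z.2 z.1 : Fin (n + 1) → ℝ) := by
        refine measurable_pi_iff.2 fun i => ?_
        refine Fin.cases ?_ (fun i => ?_) i
        · simpa using measurable_snd
        · simpa using! (measurable_pi_apply i).comp measurable_fst
      refine (Measure.ae_prod_iff_ae_ae (hm hmeas)).2 ?_
      filter_upwards [ih (fun i => ν (Fin.succAbove 0 i)) _ hcoeff] with s hs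
      have hqs : Polynomial.map (MvPolynomial.eval s) q ≠ 0 := by
        intro h
        apply hs
        rw [Polynomial.leadingCoeff, ← Polynomial.coeff_map, h, Polynomial.coeff_zero]
      have hfin := (Polynomial.map (MvPolynomial.eval s) q).roots.toFinset.finite_toSet
      refine measure_mono_null (fun y hy => ?_) (hfin.measure_zero (ν 0))
      have hy' : MvPolynomial.eval (Fin.cons y s : Fin (n + 1) → ℝ) p = 0 := not_not.1 hy
      rw [MvPolynomial.eval_eq_eval_mv_eval'] at hy'
      simpa [hqs] using hy'
    have hsw := (Measure.measurePreserving_swap (μ := ν 0)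
      (ν := Measure.pi fun i => ν (Fin.succAbove 0 i))).quasiMeasurePreserving.ae hswap
    filter_upwards [hsw] with z hz
    convert hz using 2
    simp [MeasurableEquiv.piFinSuccAbove]
    rfl

/-- A nonzero polynomial almost surely does not vanish at independent atomless random
variables. -/
lemma ae_eval_ne_zero {Ω σ : Type*} [MeasurableSpace Ω] {μ : Measure Ω} [IsProbabilityMeasure μ]
    [Fintype σ] {w : σ → Ω → ℝ} (hw_meas : ∀ e, AEMeasurable (w e) μ) (hw_indep : iIndepFun w μ)
    (hw_cont : ∀ e, NullSingletonClass (μ.map (w e))) (p : MvPolynomial σ ℝ) (hp : p ≠ 0) :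
    ∀ᵐ ω ∂μ, MvPolynomial.eval (fun e => w e ω) p ≠ 0 := by
  let g := (Fintype.equivFin σ).symm
  have hmeas : ∀ i, AEMeasurable (w (g i)) μ := fun i => hw_meas _
  have hpr : ∀ i, IsProbabilityMeasure (μ.map (w (g i))) := fun i =>
    Measure.isProbabilityMeasure_map (hmeas i)
  have hat : ∀ i, NullSingletonClass (μ.map (w (g i))) := fun i => hw_cont _
  have hmap := (hw_indep.precomp g.injective).map_fun_eq_pi_map hmeas
  have h := ae_eval_ne_zero_pi (fun i => μ.map (w (g i))) (MvPolynomial.rename g.symm p)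
    (fun h => hp ((MvPolynomial.rename_injective _ g.symm.injective).eq_iff.1
      (h.trans (map_zero _).symm)))
  rw [← hmap] at h
  filter_upwards [ae_of_ae_map (aemeasurable_pi_iff.2 hmeas) h] with ω hω
  rw [MvPolynomial.eval_rename] at hω
  convert hω using 3
  funext e
  simp

/-! ### Blocks and layers on compact sets -/

section Affine

variable {l d k : ℕ}

/-- The linear part of `blockPreact`: the same recursion without shifts and activations. -/
def blockLinear (w : WeightEntry l d k → ℝ) (j : Fin l) (γ : Fin (d ⌈/⌉ k) → Fin (d * k) → ℝ)
    (y : Fin d → ℝ) : (i : ℕ) → i ≤ d ⌈/⌉ k → Fin (d * k) → ℝ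
  | 0, _ => 0
  | i + 1, h =>
    (Matrix.diagonal (γ ⟨i, h⟩)).mulVec ((innerMat w j ⟨i, h⟩).mulVec
      (blockLinear w j γ y i (Nat.le_of_succ_le h) +
        (projMat w j ⟨i, h⟩).mulVec (chunk k y i)))

lemma continuous_chunk (i : ℕ) : Continuous fun y : Fin d → ℝ => chunk k y i := by
  refine continuous_pi fun a => ?_
  by_cases h : i * k + a < d
  · simpa [chunk, h] using continuous_apply _
  · simpa [chunk, h] using continuous_const

lemma continuous_blockLinear (w : WeightEntry l d k → ℝ) (j : Fin l)
    (γ : Fin (d ⌈/⌉ k) → Fin (d * k) → ℝ) (i : ℕ) (h : i ≤ d ⌈/⌉ k) :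
    Continuous fun y => blockLinear w j γ y i h := by
  induction i with
  | zero => exact continuous_const
  | succ i ih =>
    exact Continuous.matrix_mulVec continuous_const (Continuous.matrix_mulVec continuous_const
      ((ih _).add (Continuous.matrix_mulVec continuous_const (continuous_chunk i))))

/-- On a compact set, large shifts keep all hidden preactivations nonnegative, where the activation
is the identity. The shift of the last layer stays free. -/
lemma exists_shift_blockPreact (w : WeightEntry l d k → ℝ) (j : Fin l)
    (γ : Fin (d ⌈/⌉ k) → Fin (d * k) → ℝ) (B : Set (Fin d → ℝ)) (hB : IsCompact B)
    (hn : 0 < d ⌈/⌉ k) (b : Fin (d * k) → ℝ) :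
    ∃ β : Fin (d ⌈/⌉ k) → Fin (d * k) → ℝ, ∀ y ∈ B,
      blockPreact w j γ β y (d ⌈/⌉ k) le_rfl = blockLinear w j γ y (d ⌈/⌉ k) le_rfl + b := by
  have hbound : ∀ (i : Fin (d ⌈/⌉ k)) (s : Fin (d * k)), ∃ C : ℝ, ∀ y ∈ B,
      |blockLinear w j γ y i i.2.le s| ≤ C := by
    intro i s
    obtain ⟨C, hC⟩ := hB.exists_bound_of_continuousOn
      ((continuous_apply s).comp (continuous_blockLinear w j γ i i.2.le)).continuousOn
    exact ⟨C, hC⟩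
  choose C hC using hbound
  -- `c i` is the total shift of the `i`-th preactivation; `β` is computed from it.
  let c : ℕ → Fin (d * k) → ℝ := fun i => if i = 0 then 0 else
    if h : i < d ⌈/⌉ k then C ⟨i, h⟩ else b
  let β : Fin (d ⌈/⌉ k) → Fin (d * k) → ℝ := fun i =>
    c (i + 1) - (Matrix.diagonal (γ i)).mulVec ((innerMat w j i).mulVec (c i))
  refine ⟨β, fun y hy => ?_⟩
  have key : ∀ (i : ℕ) (h : i ≤ d ⌈/⌉ k),
      blockPreact w j γ β y i h = blockLinear w j γ y i h + c i := by
    intro i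
    induction i with
    | zero => intro h; simp [blockPreact, blockLinear, c]
    | succ i ih =>
      intro h
      have hrelu : relu (blockPreact w j γ β y i (Nat.le_of_succ_le h)) =
          blockLinear w j γ y i (Nat.le_of_succ_le h) + c i := by
        rw [ih]
        funext s
        refine max_eq_left ?_
        rcases Nat.eq_zero_or_pos i with rfl | hi
        · simp [blockLinear, c]
        · have := neg_le_of_abs_le (hC ⟨i, h⟩ s y hy)
          have hc : c i = C ⟨i, h⟩ := by
            simp only [c]
            rw [if_neg hi.ne', dif_pos (show i < d ⌈/⌉ k from h)]
          rw [Pi.add_apply, hc]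
          linarith
      rw [blockPreact, blockLinear, hrelu, add_right_comm, Matrix.mulVec_add, Matrix.mulVec_add]
      simp only [β]
      abel
  rw [key]
  simp [c, hn.ne']

/-- A matrix acts on a vector through its column blocks and the chunks of the vector. -/
lemma sum_columnBlock_mulVec_chunk (hk : 0 < k) (A : Matrix (Fin d) (Fin d) ℝ) (y : Fin d → ℝ) :
    ∑ i : Fin (d ⌈/⌉ k), (columnBlock k A i).mulVec (chunk k y i) = A.mulVec y := by
  have hd : d ≤ d ⌈/⌉ k * k := by
    have := le_smul_ceilDiv (a := k) (b := d) hk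
    rwa [smul_eq_mul, mul_comm] at this
  funext r
  let F : ℕ → ℝ := fun x => if h : x < d then A r ⟨x, h⟩ * y ⟨x, h⟩ else 0
  have h1 : A.mulVec y r = ∑ x ∈ Finset.range (d ⌈/⌉ k * k), F x := by
    rw [← Finset.sum_subset (Finset.range_mono hd)
      (fun x _ hx => dif_neg (by simpa using hx)), Finset.sum_range]
    simp [F, Matrix.mulVec, dotProduct]
  have h2 : ∑ x ∈ Finset.range (d ⌈/⌉ k * k), F x =
      ∑ i : Fin (d ⌈/⌉ k), ∑ a : Fin k, F (i * k + a) := by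
    rw [Finset.sum_range, ← finProdFinEquiv.sum_comp, Fintype.sum_prod_type]
    refine Finset.sum_congr rfl fun i _ => Finset.sum_congr rfl fun a _ => ?_
    congr 1
    simp [finProdFinEquiv, add_comm, mul_comm]
  rw [h1, h2, Finset.sum_apply]
  refine Finset.sum_congr rfl fun i _ => ?_
  simp only [Matrix.mulVec, dotProduct, columnBlock, Matrix.of_apply, chunk, F]
  refine Finset.sum_congr rfl fun a _ => ?_
  split_ifs <;> simp

/-- Let `V m` be the product of the output matrix with the last `m` pairs of a scaling and an inner
matrix. If its product with the matrix that feeds in the matching chunk is the column block of `A`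
for that chunk, for all `m ≥ 1`, then the linear part of the block computes `A`. -/
lemma outMat_mulVec_blockLinear (hk : 0 < k) (w : WeightEntry l d k → ℝ) (j : Fin l)
    (γ : Fin (d ⌈/⌉ k) → Fin (d * k) → ℝ) (A : Matrix (Fin d) (Fin d) ℝ)
    (V : ℕ → Matrix (Fin d) (Fin (d * k)) ℝ) (hV0 : V 0 = outMat w j)
    (hV : ∀ i : Fin (d ⌈/⌉ k),
      V (d ⌈/⌉ k - 1 - i + 1) =
        V (d ⌈/⌉ k - 1 - i) * Matrix.diagonal (γ i) * innerMat w j i ∧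
      V (d ⌈/⌉ k - 1 - i + 1) * projMat w j i = columnBlock k A i) (y : Fin d → ℝ) :
    (outMat w j).mulVec (blockLinear w j γ y (d ⌈/⌉ k) le_rfl) = A.mulVec y := by
  have key : ∀ (i : ℕ) (h : i ≤ d ⌈/⌉ k),
      (V (d ⌈/⌉ k - i)).mulVec (blockLinear w j γ y i h) =
        ∑ a : Fin i, (columnBlock k A a).mulVec (chunk k y a) := by
    intro i
    induction i with
    | zero => intro h; simp [blockLinear]
    | succ i ih =>
      intro h
      obtain ⟨h1, h2⟩ := hV ⟨i, h⟩
      have e1 : d ⌈/⌉ k - 1 - i + 1 = d ⌈/⌉ k - i := by omega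
      have e2 : d ⌈/⌉ k - 1 - i = d ⌈/⌉ k - (i + 1) := by omega
      simp only [e1] at h1 h2
      rw [e2] at h1
      rw [blockLinear, Matrix.mulVec_mulVec, Matrix.mulVec_mulVec, ← h1,
        Matrix.mulVec_add, ih, Matrix.mulVec_mulVec, h2, Fin.sum_univ_castSucc]
      rfl
  have := key _ le_rfl
  rw [Nat.sub_self, hV0] at this
  rw [this, sum_columnBlock_mulVec_chunk hk]

end Affine

/-- Layerwise agreement on compact sets, for a suitable choice of parameters, carries over to
compositions, because continuous images of compact sets are compact. -/
lemma exists_composeLayers_eq {V Θ : Type*} [TopologicalSpace V] (l : ℕ) (F : Fin l → V → V)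
    (G : Fin l → Θ → V → V) (hF : ∀ j, Continuous (F j))
    (h : ∀ j (B : Set V), IsCompact B → ∃ θ, ∀ y ∈ B, F j y = G j θ y) (B : Set V)
    (hB : IsCompact B) :
    ∃ θ : Fin l → Θ, ∀ x ∈ B, composeLayers l F x = composeLayers l (fun j => G j (θ j)) x := by
  induction l with
  | zero => exact ⟨Fin.elim0, fun x _ => rfl⟩
  | succ l ih =>
    obtain ⟨θ, hθ⟩ := ih (fun j => F j.castSucc) (fun j => G j.castSucc) (fun j => hF _)
      (fun j => h _)
    have hcont : ∀ (m : ℕ) (H : Fin m → V → V), (∀ j, Continuous (H j)) →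
        Continuous (composeLayers m H) := by
      intro m
      induction m with
      | zero => exact fun _ _ => continuous_id
      | succ m ihm => exact fun H hH => (hH _).comp (ihm _ fun j => hH _)
    obtain ⟨θ', hθ'⟩ := h (Fin.last l) _
      (hB.image (hcont l (fun j => F j.castSucc) fun j => hF _))
    refine ⟨Fin.snoc θ θ', fun x hx => ?_⟩
    simp only [composeLayers, Fin.snoc_castSucc, Fin.snoc_last]
    rw [← hθ x hx]
    exact hθ' _ (Set.mem_image_of_mem _ hx)

lemma continuous_activate {l : ℕ} {ι : Type*} (j : Fin l) :
    Continuous (activate j : (ι → ℝ) → ι → ℝ) := by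
  unfold activate
  split_ifs
  · exact continuous_id
  · exact continuous_pi fun a => (continuous_apply a).max continuous_const

/-! ### Almost every choice of weights is regular -/

section Generic

variable {l d k : ℕ}

/-- The chunk with number `m` when chunks are counted backwards from the last one. -/
def revChunk {n : ℕ} (hn : 0 < n) (m : ℕ) : Fin n := ⟨n - 1 - m, by omega⟩

/-- Outside the zero set of a nonzero polynomial in the weights there are scalings such that the
linear part of a block computes `A`. -/
lemma exists_polynomial_scaling (hk : 0 < k) (hn : 0 < d ⌈/⌉ k) (j : Fin l)
    (A : Matrix (Fin d) (Fin d) ℝ)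
    (hA : ∀ i i' : Fin (d ⌈/⌉ k), i < i' → columnBlock k A i' = 0 → columnBlock k A i = 0) :
    ∃ p : MvPolynomial (WeightEntry l d k) ℝ, p ≠ 0 ∧ ∀ w, MvPolynomial.eval w p ≠ 0 →
      ∃ γ : Fin (d ⌈/⌉ k) → Fin (d * k) → ℝ, ∀ y,
        (outMat w j).mulVec (blockLinear w j γ y (d ⌈/⌉ k) le_rfl) = A.mulVec y := by
  classical
  let e : Fin (d * k) ≃ Fin d × Fin k := finProdFinEquiv.symm
  let A' : ℕ → Matrix (Fin d) (Fin k) ℝ := fun m => columnBlock k A (revChunk hn m)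
  -- Counted backwards, the chunks with number less than `N` are those with a nonzero block.
  obtain ⟨N, hN1, hN2⟩ : ∃ N, (∀ m < N, A' m ≠ 0) ∧ ∀ m, N ≤ m → m < d ⌈/⌉ k → A' m = 0 := by
    have hex : ∃ m, d ⌈/⌉ k ≤ m ∨ A' m = 0 := ⟨_, Or.inl le_rfl⟩
    refine ⟨Nat.find hex, fun m hm h => Nat.find_min hex hm (Or.inr h), fun m hm hmn => ?_⟩
    have hz := (Nat.find_spec hex).resolve_left (by omega)
    rcases hm.eq_or_lt with h | h
    · rwa [← h]
    · refine hA _ _ ?_ hz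
      rw [revChunk, revChunk, Fin.mk_lt_mk]
      omega
  -- The determinants of the systems as polynomials in the weights.
  let D : ℕ → MvPolynomial (WeightEntry l d k) ℝ := chainDet e
    (fun m => (A' m).map MvPolynomial.C)
    (fun m => Matrix.of fun r c => MvPolynomial.X (.inner j (revChunk hn m) r c))
    (fun m => Matrix.of fun r c => MvPolynomial.X (.proj j (revChunk hn m) r c))
    (Matrix.of fun r c => MvPolynomial.X (.out j r c))
  have heval : ∀ w m, MvPolynomial.eval w (D m) = chainDet e A'
      (fun m => innerMat w j (revChunk hn m)) (fun m => projMat w j (revChunk hn m))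
      (outMat w j) m := by
    intro w m
    simp only [D]
    rw [chainDet_map]
    congr 1
    · funext i; ext r c; simp
    · funext i; ext r c; simp [innerMat]
    · funext i; ext r c; simp [projMat]
    · ext r c; simp [outMat]
  refine ⟨∏ m ∈ Finset.range N, D m, ?_, ?_⟩
  · obtain ⟨V, hV⟩ := exists_common_regular e
      (fun i : {i : Fin (d ⌈/⌉ k) // columnBlock k A i ≠ 0} => columnBlock k A i) fun i => i.2
    choose P hP using hV
    let w₀ : WeightEntry l d k → ℝ := fun x => match x with
      | .inner _ _ r c => (1 : Matrix (Fin (d * k)) (Fin (d * k)) ℝ) r c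
      | .proj _ i r c => if h : columnBlock k A i ≠ 0 then P ⟨i, h⟩ r c else 0
      | .out _ r c => V r c
    refine Finset.prod_ne_zero_iff.2 fun m hm h0 => ?_
    rw [Finset.mem_range] at hm
    have h1 := heval w₀ m
    rw [h0, map_zero] at h1
    refine chainDet_one_ne_zero e A' (fun m => projMat w₀ j (revChunk hn m)) V N
      (fun m hm => ?_) m hm h1.symm
    have hP' : projMat w₀ j (revChunk hn m) = P ⟨revChunk hn m, hN1 m hm⟩ := by
      ext r c
      exact dif_pos (hN1 m hm)
    rw [hP']
    exact hP _
  · intro w hw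
    rw [map_prod, Finset.prod_ne_zero_iff] at hw
    obtain ⟨γ, V, hV0, hV⟩ := exists_scaling_of_chainDet_ne_zero e A'
      (fun m => innerMat w j (revChunk hn m)) (fun m => projMat w j (revChunk hn m))
      (outMat w j) N (fun m hm => heval w m ▸ hw m (Finset.mem_range.2 hm))
    refine ⟨fun i => γ (d ⌈/⌉ k - 1 - i), fun y =>
      outMat_mulVec_blockLinear hk w j _ A V hV0 (fun i => ?_) y⟩
    have hrev : revChunk hn (d ⌈/⌉ k - 1 - i) = i := by
      ext
      simp only [revChunk]
      omega
    have := hV (d ⌈/⌉ k - 1 - i) (fun h => hN2 _ h (by omega))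
    simpa only [A', hrev] using this

/-- Outside the zero set of a nonzero polynomial in the weights an output matrix has full row
rank. -/
lemma exists_polynomial_outMat_surjective (hk : 0 < k) (j : Fin l) :
    ∃ p : MvPolynomial (WeightEntry l d k) ℝ, p ≠ 0 ∧ ∀ w, MvPolynomial.eval w p ≠ 0 →
      Function.Surjective (outMat w j).mulVec := by
  classical
  let s : Fin d → Fin (d * k) := fun c => finProdFinEquiv (c, ⟨0, hk⟩)
  have hs : Function.Injective s := fun a b h => (Prod.ext_iff.1 (finProdFinEquiv.injective h)).1
  let M : Matrix (Fin d) (Fin d) (MvPolynomial (WeightEntry l d k) ℝ) :=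
    Matrix.of fun r c => MvPolynomial.X (.out j r (s c))
  have heval : ∀ w, MvPolynomial.eval w M.det = ((outMat w j).submatrix id s).det := by
    intro w
    rw [RingHom.map_det]
    congr 1
    ext r c
    simp [M, outMat]
  refine ⟨M.det, fun h0 => ?_, fun w hw b => ?_⟩
  · let w₀ : WeightEntry l d k → ℝ := fun x => match x with
      | .inner _ _ _ _ => 0
      | .proj _ _ _ _ => 0
      | .out _ r c => if s r = c then 1 else 0
    have h1 : (outMat w₀ j).submatrix id s = 1 := by
      ext r c
      simp [outMat, w₀, Matrix.one_apply, hs.eq_iff]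
    have h2 := heval w₀
    rw [h0, h1, map_zero, Matrix.det_one] at h2
    exact zero_ne_one h2
  · rw [heval] at hw
    have hmul : outMat w j * (1 : Matrix (Fin (d * k)) (Fin (d * k)) ℝ).submatrix id s =
        (outMat w j).submatrix id s := by
      ext r c
      simp [Matrix.mul_apply, Matrix.one_apply]
    refine ⟨((1 : Matrix (Fin (d * k)) (Fin (d * k)) ℝ).submatrix id s).mulVec
      (((outMat w j).submatrix id s)⁻¹.mulVec b), ?_⟩
    rw [Matrix.mulVec_mulVec, hmul, Matrix.mulVec_mulVec, Matrix.mul_nonsing_inv _ hw.isUnit,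
      Matrix.one_mulVec]

end Generic

end NormNet

theorem theorem2 {Ω : Type*} [MeasurableSpace Ω] (μ : Measure Ω) [IsProbabilityMeasure μ]
    (l d k : ℕ) (hk : 1 ≤ k) (hkd : k ≤ d)
    (Wstar : Fin l → Matrix (Fin d) (Fin d) ℝ) (γstar βstar : Fin l → Fin d → ℝ)
    (hblock : ∀ (j : Fin l) (i i' : Fin (d ⌈/⌉ k)), i < i' →
      NormNet.columnBlock k (Matrix.diagonal (γstar j) * Wstar j) i' = 0 →
      NormNet.columnBlock k (Matrix.diagonal (γstar j) * Wstar j) i = 0)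
    (w : NormNet.WeightEntry l d k → Ω → ℝ)
    (hw_meas : ∀ e, AEMeasurable (w e) μ)
    (hw_indep : iIndepFun w μ)
    (hw_cont : ∀ e, NullSingletonClass (μ.map (w e))) :
    ∀ᵐ ω ∂μ, ∃ γ β : Fin l → Fin (d ⌈/⌉ k) → Fin (d * k) → ℝ,
      ∀ x : EuclideanSpace ℝ (Fin d), ‖x‖ ≤ 1 →
        NormNet.targetNet Wstar γstar βstar x.ofLp =
          NormNet.deepNet (fun e => w e ω) γ β x.ofLp := by
  have hn : 0 < d ⌈/⌉ k := by
    rw [Nat.ceilDiv_eq_add_pred_div]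
    exact Nat.div_pos (by omega) hk
  choose p hp hpw using fun j => NormNet.exists_polynomial_scaling hk hn j _ (hblock j)
  choose q hq hqw using fun j : Fin l =>
    NormNet.exists_polynomial_outMat_surjective (d := d) hk j
  have hae := fun j => (NormNet.ae_eval_ne_zero hw_meas hw_indep hw_cont (p j) (hp j)).and
    (NormNet.ae_eval_ne_zero hw_meas hw_indep hw_cont (q j) (hq j))
  filter_upwards [ae_all_iff.2 hae] with ω hω
  have hcompact : IsCompact ((EuclideanSpace.equiv (Fin d) ℝ) ''
      Metric.closedBall (0 : EuclideanSpace ℝ (Fin d)) 1) :=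
    (isCompact_closedBall _ _).image (EuclideanSpace.equiv (Fin d) ℝ).continuous
  obtain ⟨θ, hθ⟩ := NormNet.exists_composeLayers_eq
    (Θ := (Fin (d ⌈/⌉ k) → Fin (d * k) → ℝ) × (Fin (d ⌈/⌉ k) → Fin (d * k) → ℝ)) l
    (fun j y => NormNet.activate j
      ((Matrix.diagonal (γstar j)).mulVec ((Wstar j).mulVec y) + βstar j))
    (fun j θ y => NormNet.activate j ((NormNet.outMat (fun e => w e ω) j).mulVec
      (NormNet.blockPreact (fun e => w e ω) j θ.1 θ.2 y (d ⌈/⌉ k) le_rfl)))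
    (fun j => (NormNet.continuous_activate j).comp
      ((Continuous.matrix_mulVec continuous_const
        (Continuous.matrix_mulVec continuous_const continuous_id)).add continuous_const))
    (fun j B hB => by
      obtain ⟨γ, hγ⟩ := hpw j _ (hω j).1
      obtain ⟨b, hb⟩ := hqw j _ (hω j).2 (βstar j)
      obtain ⟨β, hβ⟩ := NormNet.exists_shift_blockPreact (fun e => w e ω) j γ B hB hn b
      refine ⟨(γ, β), fun y hy => ?_⟩
      rw [hβ y hy, Matrix.mulVec_add, hγ, hb, Matrix.mulVec_mulVec])
    _ hcompact
  refine ⟨fun j => (θ j).1, fun j => (θ j).2, fun x hx => ?_⟩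
  exact hθ x.ofLp ⟨x, by simpa using hx, rfl⟩
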